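/- Let $1<r\le 2$. A sequence $(X_i)_{i\ge 0}$ of integrable random variables with values in a Banach space $B$ is a martingale difference sequence for a filtration $(\mathcal F_i)_{i\ge0}$ if each $X_i$ is $\mathcal F_i$-measurable and $\mathbb E[X_i\mid\mathcal F_{i-1}]=0$ almost surely for every $i\ge1$. A separable real Banach space $(B,\|\cdot\|_B)$ is called $(r,D)$-smooth if it admits an equivalent norm $\|\cdot\|$ with $$\sup_{t>0}\frac1{t^r}\sup\{\|x+ty\|+\|x-ty\|-2:\ \|x\|=\|y\|=1\}<\infty$$ and if $\mathbb E\big\|\sum_{i<n}X_i\big\|_B^r\le D\sum_{i<n}\mathbb E\|X_i\|_B^r$ for every $n$ and every $B$-valued martingale difference sequence $(X_i)_{i\ge 0}$. For $s>1$ and a $B$-valued random variable $X$, write $X\in\mathbb L^{s,\infty}$ if $\sup_{t>0}t^s\,\mathbb P(\|X\|_B>t)<\infty$, and $X\in\mathbb L^{s,\infty}_0$ if $\lim_{t\to\infty}t^s\,\mathbb P(\|X\|_B>t)=0$. Let $s>2$ and let $B$ be a separable $(2,D)$-smooth Banach space. Then there is a constant $C=C(s,B)$ such that the following holds for every probability space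 $(\Omega,\mathcal F,\mathbb P)$, every bijective, bimeasurable, measure-preserving map $T:\Omega\to\Omega$, every sub-$\sigma$-algebra $\mathcal F_0\subset\mathcal F$ with $T\mathcal F_0\subset\mathcal F_0$, and every $m:\Omega\to B$ such that $(m\circ T^i)_{i\ge0}$ is a martingale difference sequence for the filtration $(T^{-i}\mathcal F_0)_{i\ge0}$. Put $S_i(m)=\sum_{j=0}^{i-1}m\circ T^j$. 1. If $m\in\mathbb L^{s,\infty}$, then $$\sup_{n\ge1}\sup_{x>0}x^s\,2^{ns/2}\,\mathbb P\Big(\max_{1\le i\le2^n}\|S_i(m)\|_B>2^nx\Big)\le C\sup_{t>0}t^s\,\mathbb P(\|m\|_B>t).$$ 2. If $m\in\mathbb L^{s,\infty}_0$, then for every $x>0$, $$\lim_{n\to\infty}2^{ns/2}\,\mathbb P\Big(\max_{1\le i\le2^n}\|S_i(m)\|_B>2^nx\Big)=0.$$ 3. If $m\in\mathbb L^{s}$, then for every $x>0$, $$\sum_{n=1}^{\infty}2^{ns/2}\,\mathbb P\Big(\max_{1\le i\le2^n}\|S_i(m)\|_B>2^nx\Big)\le C\,x^{-s}\,\mathbb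 E\|m\|_B^s.$$ -/

import Mathlib

open MeasureTheory Filter Topology
open scoped NNReal ENNReal

universe u v

/-- `X 0, X 1, …` is a `B`-valued martingale difference sequence for the filtration `F`: each `X i`
is `F i`-measurable and integrable, and `E[X (i + 1) | F i] = 0` almost surely.  (As usual, nothing
is asked of the mean of the first term.) -/
structure IsMartingaleDifference {Ω B : Type*} [NormedAddCommGroup B] [NormedSpace ℝ B]
    [CompleteSpace B] {mΩ : MeasurableSpace Ω} (μ : Measure Ω) (F : Filtration ℕ mΩ)
    (X : ℕ → Ω → B) : Prop where
  measurable : ∀ i, StronglyMeasurable[F i] (X i)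
  integrable : ∀ i, Integrable (X i) μ
  condExp_eq_zero : ∀ i, μ[X (i + 1) | F i] =ᵐ[μ] 0

/-- `B` is `r`-smooth: there is an equivalent norm `N` on `B` such that
`sup_{t > 0} t ^ (-r) * sup {N (x + t y) + N (x - t y) - 2 : N x = N y = 1}` is finite. -/
def IsSmoothSpace (r : ℝ) (B : Type*) [NormedAddCommGroup B] [NormedSpace ℝ B] : Prop :=
  ∃ N : Seminorm ℝ B,
    (∃ a b : ℝ, 0 < a ∧ 0 < b ∧ ∀ x : B, a * ‖x‖ ≤ N x ∧ N x ≤ b * ‖x‖) ∧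
    ∃ K : ℝ, ∀ t : ℝ, 0 < t → ∀ x y : B, N x = 1 → N y = 1 →
      (N (x + t • y) + N (x - t • y) - 2) / t ^ r ≤ K

/-- `B` is `(r, D)`-smooth: it is `r`-smooth and every `B`-valued martingale difference sequence
satisfies `E ‖X 0 + ⋯ + X (n - 1)‖ ^ r ≤ D * ∑ i < n, E ‖X i‖ ^ r`, both sides being in `[0, ∞]`.
The probability spaces range over an arbitrary universe `v`; since the inequality only concerns the
law of the sequence in `ℕ → B`, with `B` separable, the choice of `v` does not matter. -/
def IsSmoothSpaceWith (r : ℝ) (D : ℝ≥0) (B : Type u) [NormedAddCommGroup B]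
    [NormedSpace ℝ B] [CompleteSpace B] : Prop :=
  IsSmoothSpace r B ∧
    ∀ (Ω : Type v) (mΩ : MeasurableSpace Ω) (μ : Measure Ω) (F : Filtration ℕ mΩ) (X : ℕ → Ω → B),
      IsProbabilityMeasure μ → IsMartingaleDifference μ F X →
      ∀ n : ℕ, ∫⁻ ω, ‖∑ i ∈ Finset.range n, X i ω‖ₑ ^ r ∂μ
        ≤ D * ∑ i ∈ Finset.range n, ∫⁻ ω, ‖X i ω‖ₑ ^ r ∂μ

/-- The filtration `F i = T⁻ⁱ F₀` (the preimages under `T ^ i` of the sets of `F₀`), for a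
bijective bimeasurable `T` and a sub-σ-algebra `F₀` such that `T F₀ ⊆ F₀`.  The image σ-algebra
`T F₀` consists of the preimages of the sets of `F₀` under the inverse of `T`. -/
def shiftFiltration {Ω : Type*} (F₀ : MeasurableSpace Ω) {mΩ : MeasurableSpace Ω} (T : Ω ≃ᵐ Ω)
    (hF₀ : F₀ ≤ mΩ) (hT : F₀.comap T.symm ≤ F₀) : Filtration ℕ mΩ where
  seq i := F₀.comap (T^[i])
  mono' := by
    refine monotone_nat_of_le_succ fun i => ?_
    have h : F₀ ≤ F₀.comap T := by
      have h1 := MeasurableSpace.comap_mono (g := T) hT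
      rwa [MeasurableSpace.comap_comp, T.symm_comp_self, MeasurableSpace.comap_id] at h1
    rw [Function.iterate_succ', ← MeasurableSpace.comap_comp]
    exact MeasurableSpace.comap_mono h
  le' i := (MeasurableSpace.comap_mono hF₀).trans (T.measurable.iterate i).comap_le

/-- `sup_{t > 0} t ^ s * P(‖X‖ > t)`, in `[0, ∞]`. -/
noncomputable def weakMoment {Ω B : Type*} [NormedAddCommGroup B] {mΩ : MeasurableSpace Ω}
    (s : ℝ) (X : Ω → B) (μ : Measure Ω) : ℝ≥0∞ :=
  ⨆ (t : ℝ) (_ : 0 < t), ENNReal.ofReal (t ^ s) * μ {ω | t < ‖X ω‖}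

/-- `X` belongs to `L^{s,∞}`. -/
def MemWeakLp {Ω B : Type*} [NormedAddCommGroup B] {mΩ : MeasurableSpace Ω}
    (s : ℝ) (X : Ω → B) (μ : Measure Ω) : Prop :=
  AEStronglyMeasurable X μ ∧ weakMoment s X μ < ∞

/-- `X` belongs to `L_0^{s,∞}`: `t ^ s * P(‖X‖ > t) → 0` as `t → ∞`. -/
def MemWeakLpZero {Ω B : Type*} [NormedAddCommGroup B] {mΩ : MeasurableSpace Ω}
    (s : ℝ) (X : Ω → B) (μ : Measure Ω) : Prop :=
  AEStronglyMeasurable X μ ∧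
    Tendsto (fun t : ℝ => ENNReal.ofReal (t ^ s) * μ {ω | t < ‖X ω‖}) atTop (𝓝 0)

/-- `max_{1 ≤ i ≤ N} ‖S_i(m)‖` at `ω`, where `S_i(m) = ∑ j < i, m ∘ T ^ j` and `N ≥ 1`. -/
noncomputable def maxPartialSum {Ω B : Type*} [NormedAddCommGroup B] (T : Ω → Ω) (m : Ω → B)
    (N : ℕ) (ω : Ω) : ℝ≥0 :=
  (Finset.Icc 1 N).sup fun i => ‖birkhoffSum T m i ω‖₊

/-- `P(max_{1 ≤ i ≤ 2 ^ n} ‖S_i(m)‖ > 2 ^ n * x)`. -/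
noncomputable def largeDeviationProb {Ω B : Type*} [NormedAddCommGroup B]
    {mΩ : MeasurableSpace Ω} (μ : Measure Ω) (T : Ω → Ω) (m : Ω → B) (n : ℕ) (x : ℝ) : ℝ≥0∞ :=
  μ {ω | 2 ^ n * x < (maxPartialSum T m (2 ^ n) ω : ℝ)}

/-!
The deviation probabilities of the martingale at the levels `3 * lam` and `lam` are compared by a
good-`λ` inequality. Let `S i` be the partial sums and `Q i` the sums of the squares `‖X j‖ ^ 2`,
`j < i`. Keep only those increments that come after the first passage of `‖S‖` above `lam`, before
its first passage above `3 * lam`, and while `Q` is at most `d ^ 2`, where `d = δ * lam`. This is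
again a martingale difference sequence, so the moment inequality defining `(2, D)`-smoothness
applies to it. Its sum exceeds `lam` whenever `‖S‖` passes `3 * lam` and `Q ≤ d ^ 2`, and its
squares sum to at most `2 * d ^ 2` plus the squares of the increments exceeding `d`
(`IsMartingaleDifference.good_lambda`). The event that `Q` is large is handled by Markov's
inequality after a truncation (`measure_lt_sum_sq_le`). Working with `Q` instead of the conditional
variances makes the truncated second moments `E[‖m‖ ^ 2; ‖m‖ > z]` the only error terms.

For the stationary sequence `m ∘ T^[i]` and `lam = 2 ^ n * x` this says that
`h n x = x ^ s * 2 ^ (n s / 2) * P(max_{i ≤ 2 ^ n} ‖S i‖ > 2 ^ n * x)` satisfies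
`h n (3 * x) ≤ h n x / 2 + c * z ^ (s - 2) * E[‖m‖ ^ 2; ‖m‖ > z]` with `z` proportional to
`2 ^ (n / 2) * x`, once `δ` is small (`exists_normalizedDeviation_three_mul_le`). Such a recursion
bounds `h` by twice its error term (`le_two_mul_of_three_mul_le`). Since `s > 2`, the error term is
at most a constant times the weak moment of `m`, it tends to `0` as `z → ∞` if `m` is in the small
weak space, and its sum over `n` is at most a constant times `E ‖m‖ ^ s`.
-/

/-! ### Sequences of vectors between two crossing times -/

/-- The index `i` lies between the first passage of the partial sums of `x` above `lam` and their
first passage above `3 * lam`, and the squares summed before `i` do not exceed `d ^ 2`.  Only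
`x 0, …, x (i - 1)` matter, which makes the condition predictable. -/
def BetweenCrossings {B : Type*} [NormedAddCommGroup B] (lam d : ℝ) (x : ℕ → B) (i : ℕ) : Prop :=
  (∃ j ≤ i, lam < ‖∑ k ∈ Finset.range j, x k‖) ∧
    (∀ j ≤ i, ‖∑ k ∈ Finset.range j, x k‖ ≤ 3 * lam) ∧
    ∑ k ∈ Finset.range i, ‖x k‖ ^ 2 ≤ d ^ 2

section Deterministic

variable {B : Type*} [NormedAddCommGroup B]

open scoped Classical in
/-- The sum over the indices between the crossings is `S σ - S τ` for the two passage times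
`τ ≤ σ`; as a jump is at most `lam`, `‖S τ‖ ≤ 2 * lam`. -/
theorem lt_norm_sum_betweenCrossings {lam d : ℝ} (hlam : 0 < lam) (hd : 0 ≤ d) (hdl : d ≤ lam)
    (x : ℕ → B) (N : ℕ) (hN : ∃ i ≤ N, 3 * lam < ‖∑ k ∈ Finset.range i, x k‖)
    (hQ : ∑ k ∈ Finset.range N, ‖x k‖ ^ 2 ≤ d ^ 2) :
    lam < ‖∑ i ∈ Finset.range N, if BetweenCrossings lam d x i then x i else 0‖ := by
  set S : ℕ → B := fun i => ∑ k ∈ Finset.range i, x k with hS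
  have hex : ∃ i, 3 * lam < ‖S i‖ := hN.imp fun i h => h.2
  have hex' : ∃ i, lam < ‖S i‖ := hex.imp fun i h => by linarith
  set σ := Nat.find hex with hσ
  set τ := Nat.find hex' with hτ
  have hσs : 3 * lam < ‖S σ‖ := Nat.find_spec hex
  have hτs : lam < ‖S τ‖ := Nat.find_spec hex'
  have hσN : σ ≤ N := by
    obtain ⟨i, hi, h⟩ := hN
    exact (Nat.find_min' hex h).trans hi
  have hτσ : τ ≤ σ := Nat.find_min' hex' (by linarith)
  have hτ0 : τ ≠ 0 := by
    intro h0
    rw [h0] at hτs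
    simp [hS] at hτs
    linarith
  have hiff : ∀ i ∈ Finset.range N, (BetweenCrossings lam d x i ↔ τ ≤ i ∧ i < σ) := by
    intro i hi
    constructor
    · rintro ⟨⟨j, hj, h⟩, h2, -⟩
      refine ⟨(Nat.find_min' hex' h).trans hj, ?_⟩
      by_contra! hc
      exact absurd (h2 σ hc) (not_le.mpr hσs)
    · rintro ⟨h1, h2⟩
      refine ⟨⟨τ, h1, hτs⟩, fun j hj => not_lt.mp (Nat.find_min hex (hj.trans_lt h2)), ?_⟩
      refine le_trans (Finset.sum_le_sum_of_subset_of_nonneg ?_ fun _ _ _ => by positivity) hQ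
      exact Finset.range_subset_range.mpr (Finset.mem_range.mp hi).le
  have hsum : ∑ i ∈ Finset.range N, (if BetweenCrossings lam d x i then x i else 0)
      = S σ - S τ := by
    rw [← Finset.sum_filter, hS, ← Finset.sum_Ico_eq_sub _ hτσ]
    congr 1
    ext i
    simp only [Finset.mem_filter, Finset.mem_Ico]
    constructor
    · rintro ⟨hi, h⟩
      exact (hiff i hi).1 h
    · intro h
      have hi : i ∈ Finset.range N := Finset.mem_range.mpr (h.2.trans_le hσN)
      exact ⟨hi, (hiff i hi).2 h⟩
  have hStau : ‖S τ‖ ≤ 2 * lam := by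
    obtain ⟨t, ht⟩ := Nat.exists_eq_succ_of_ne_zero hτ0
    have h1 : ‖S t‖ ≤ lam := not_lt.mp (Nat.find_min hex' (by omega))
    have h2 : ‖x t‖ ≤ d := by
      have htN : t ∈ Finset.range N := Finset.mem_range.mpr (by omega)
      have := Finset.single_le_sum (f := fun k => ‖x k‖ ^ 2) (fun _ _ => by positivity) htN
      exact le_of_sq_le_sq (this.trans hQ) hd
    have h3 : S τ = S t + x t := by rw [ht]; simp [hS, Finset.sum_range_succ]
    rw [h3]
    linarith [norm_add_le (S t) (x t)]
  rw [hsum]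
  linarith [norm_sub_norm_le (S σ) (S τ)]

open scoped Classical in
/-- All squares between the crossings except the last one sum to at most `d ^ 2`, by the third
condition in `BetweenCrossings`; the last one is at most `d ^ 2` unless it is large. -/
theorem sum_sq_betweenCrossings_le (lam d : ℝ) (x : ℕ → B) (N : ℕ) :
    ∑ i ∈ Finset.range N, (if BetweenCrossings lam d x i then ‖x i‖ ^ 2 else 0)
      ≤ (if ∃ i ≤ N, lam < ‖∑ k ∈ Finset.range i, x k‖ then 2 * d ^ 2 else 0)
        + ∑ i ∈ Finset.range N, (if d < ‖x i‖ then ‖x i‖ ^ 2 else 0) := by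
  have hnn : ∀ i, 0 ≤ (if d < ‖x i‖ then ‖x i‖ ^ 2 else 0) := fun i => by split_ifs <;> positivity
  rw [← Finset.sum_filter]
  set J := (Finset.range N).filter (BetweenCrossings lam d x) with hJ
  rcases J.eq_empty_or_nonempty with h | h
  · rw [h, Finset.sum_empty]
    exact add_nonneg (by split_ifs <;> positivity) (Finset.sum_nonneg fun i _ => hnn i)
  · set l := J.max' h with hl
    have hlJ : l ∈ J := J.max'_mem h
    obtain ⟨hlN, ⟨j, hj, hlam⟩, -, hQ⟩ := Finset.mem_filter.mp hlJ
    have hlN' := Finset.mem_range.mp hlN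
    rw [if_pos ⟨j, by omega, hlam⟩]
    have h1 : ∑ i ∈ J, ‖x i‖ ^ 2 ≤ ∑ i ∈ Finset.range (l + 1), ‖x i‖ ^ 2 := by
      refine Finset.sum_le_sum_of_subset_of_nonneg (fun i hi => ?_) fun _ _ _ => by positivity
      exact Finset.mem_range.mpr (Nat.lt_succ_of_le (J.le_max' i hi))
    rw [Finset.sum_range_succ] at h1
    have h2 : ‖x l‖ ^ 2 ≤ d ^ 2 + (if d < ‖x l‖ then ‖x l‖ ^ 2 else 0) := by
      split_ifs with hc
      · nlinarith
      · have := not_lt.mp hc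
        have := pow_le_pow_left₀ (norm_nonneg (x l)) this 2
        linarith
    have h3 := Finset.single_le_sum (f := fun i => (if d < ‖x i‖ then ‖x i‖ ^ 2 else 0))
      (fun i _ => hnn i) hlN
    linarith

end Deterministic

/-! ### A distribution inequality for martingale differences -/

theorem enorm_rpow_two_eq_ofReal {B : Type*} [NormedAddCommGroup B] (x : B) :
    ‖x‖ₑ ^ (2 : ℝ) = ENNReal.ofReal (‖x‖ ^ 2) := by
  rw [← ofReal_norm, ENNReal.ofReal_rpow_of_nonneg (norm_nonneg _) (by norm_num),
    Real.rpow_two]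

section MartingaleDifference

variable {Ω : Type v} {B : Type u} [NormedAddCommGroup B] [NormedSpace ℝ B] [CompleteSpace B]
  {mΩ : MeasurableSpace Ω} {μ : Measure Ω} {F : Filtration ℕ mΩ} {X : ℕ → Ω → B}

theorem IsMartingaleDifference.stronglyMeasurable_sum (hX : IsMartingaleDifference μ F X)
    {i j : ℕ} (hj : j ≤ i + 1) :
    StronglyMeasurable[F i] fun ω => ∑ k ∈ Finset.range j, X k ω :=
  Finset.stronglyMeasurable_fun_sum _ fun k hk =>
    (hX.measurable k).mono (F.mono (by have := Finset.mem_range.mp hk; omega))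

theorem IsMartingaleDifference.measurableSet_betweenCrossings (hX : IsMartingaleDifference μ F X)
    (lam d : ℝ) (i : ℕ) :
    MeasurableSet[F i] {ω | BetweenCrossings lam d (fun k => X k ω) (i + 1)} := by
  have h1 : ∀ j ≤ i + 1, Measurable[F i] fun ω => ‖∑ k ∈ Finset.range j, X k ω‖ :=
    fun j hj => (hX.stronglyMeasurable_sum hj).norm.measurable
  have h2 : Measurable[F i] fun ω => ∑ k ∈ Finset.range (i + 1), ‖X k ω‖ ^ 2 :=
    Finset.measurable_fun_sum _ fun k hk => (((hX.measurable k).mono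
      (F.mono (by have := Finset.mem_range.mp hk; omega))).norm.measurable.pow_const 2)
  have e : {ω | BetweenCrossings lam d (fun k => X k ω) (i + 1)}
      = (⋃ j, ⋃ (_ : j ≤ i + 1), {ω | lam < ‖∑ k ∈ Finset.range j, X k ω‖}) ∩
        ((⋂ j, ⋂ (_ : j ≤ i + 1), {ω | ‖∑ k ∈ Finset.range j, X k ω‖ ≤ 3 * lam}) ∩
          {ω | ∑ k ∈ Finset.range (i + 1), ‖X k ω‖ ^ 2 ≤ d ^ 2}) := by
    ext ω
    simp [BetweenCrossings]
  rw [e]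
  refine MeasurableSet.inter ?_ (MeasurableSet.inter ?_ ?_)
  · exact MeasurableSet.iUnion fun j => MeasurableSet.iUnion fun hj =>
      (h1 j hj) measurableSet_Ioi
  · exact MeasurableSet.iInter fun j => MeasurableSet.iInter fun hj =>
      (h1 j hj) measurableSet_Iic
  · exact h2 measurableSet_Iic

open scoped Classical in
theorem IsMartingaleDifference.betweenCrossings (hX : IsMartingaleDifference μ F X)
    [IsFiniteMeasure μ] {lam d : ℝ} (hlam : 0 ≤ lam) :
    IsMartingaleDifference μ F fun i ω =>
      if BetweenCrossings lam d (fun k => X k ω) i then X i ω else 0 := by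
  have h0 : ∀ ω, ¬ BetweenCrossings lam d (fun k => X k ω) 0 := by
    rintro ω ⟨⟨j, hj, h⟩, -⟩
    obtain rfl : j = 0 := by omega
    simp at h
    linarith
  have hind : ∀ i, (fun ω => if BetweenCrossings lam d (fun k => X k ω) i then X i ω else 0)
      = {ω | BetweenCrossings lam d (fun k => X k ω) i}.indicator (X i) := by
    intro i
    ext ω
    simp [Set.indicator_apply]
  have hz : {ω | BetweenCrossings lam d (fun k => X k ω) 0} = ∅ := by
    ext ω
    simp [h0 ω]
  refine ⟨fun i => ?_, fun i => ?_, fun i => ?_⟩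
  · rw [hind]
    cases i with
    | zero => rw [hz, Set.indicator_empty]; exact stronglyMeasurable_zero
    | succ i =>
      exact (hX.measurable _).indicator
        (F.mono (Nat.le_succ i) _ (hX.measurableSet_betweenCrossings lam d i))
  · rw [hind]
    cases i with
    | zero => rw [hz, Set.indicator_empty]; exact integrable_zero _ _ _
    | succ i =>
      exact (hX.integrable _).indicator (F.le i _ (hX.measurableSet_betweenCrossings lam d i))
  · rw [hind]
    filter_upwards [condExp_indicator (hX.integrable (i + 1))
      (hX.measurableSet_betweenCrossings lam d i), hX.condExp_eq_zero i] with ω h1 h2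
    rw [h1, Set.indicator_apply, h2]
    simp

open scoped Classical in
/-- A good-`λ` inequality: when the sum of squares is small, the partial sums rarely reach
`3 * lam` after having reached `lam`. -/
theorem IsMartingaleDifference.good_lambda {D : ℝ≥0} (hB : IsSmoothSpaceWith.{u, v} 2 D B)
    [IsProbabilityMeasure μ] (hX : IsMartingaleDifference μ F X) {lam d : ℝ} (hlam : 0 < lam)
    (hd : 0 ≤ d) (hdl : d ≤ lam) (N : ℕ) :
    ENNReal.ofReal (lam ^ 2) * μ {ω | (∃ i ≤ N, 3 * lam < ‖∑ k ∈ Finset.range i, X k ω‖) ∧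
        ∑ k ∈ Finset.range N, ‖X k ω‖ ^ 2 ≤ d ^ 2}
      ≤ D * (ENNReal.ofReal (2 * d ^ 2) *
          μ {ω | ∃ i ≤ N, lam < ‖∑ k ∈ Finset.range i, X k ω‖} +
        ∑ i ∈ Finset.range N, ∫⁻ ω in {ω | d < ‖X i ω‖}, ‖X i ω‖ₑ ^ (2 : ℝ) ∂μ) := by
  have hXm : ∀ i, StronglyMeasurable (X i) := fun i => (hX.measurable i).mono (F.le i)
  have hY := hX.betweenCrossings (d := d) hlam.le
  set Y : ℕ → Ω → B := fun i ω => if BetweenCrossings lam d (fun k => X k ω) i then X i ω else 0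
    with hYdef
  have hYm : ∀ i, StronglyMeasurable (Y i) := fun i => (hY.measurable i).mono (F.le i)
  have hmS : MeasurableSet {ω | ∃ i ≤ N, lam < ‖∑ k ∈ Finset.range i, X k ω‖} := by
    have e : {ω | ∃ i ≤ N, lam < ‖∑ k ∈ Finset.range i, X k ω‖}
        = ⋃ i, ⋃ (_ : i ≤ N), {ω | lam < ‖∑ k ∈ Finset.range i, X k ω‖} := by
      ext ω
      simp
    rw [e]
    refine MeasurableSet.iUnion fun i => MeasurableSet.iUnion fun _ => ?_
    exact (Finset.stronglyMeasurable_fun_sum _ fun k _ => hXm k).norm.measurable measurableSet_Ioi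
  have hmX : ∀ i, MeasurableSet {ω | d < ‖X i ω‖} := fun i =>
    (hXm i).norm.measurable measurableSet_Ioi
  calc _ ≤ ENNReal.ofReal (lam ^ 2) * μ {ω | ENNReal.ofReal (lam ^ 2)
          ≤ ‖∑ i ∈ Finset.range N, Y i ω‖ₑ ^ (2 : ℝ)} := by
        gcongr with ω
        rintro ⟨h1, h2⟩
        rw [enorm_rpow_two_eq_ofReal]
        have := lt_norm_sum_betweenCrossings hlam hd hdl (fun k => X k ω) N h1 h2
        exact ENNReal.ofReal_le_ofReal (pow_le_pow_left₀ hlam.le this.le 2)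
    _ ≤ ∫⁻ ω, ‖∑ i ∈ Finset.range N, Y i ω‖ₑ ^ (2 : ℝ) ∂μ := by
        apply mul_meas_ge_le_lintegral
        exact (Finset.stronglyMeasurable_fun_sum _ fun k _ => hYm k).enorm.pow_const _
    _ ≤ D * ∑ i ∈ Finset.range N, ∫⁻ ω, ‖Y i ω‖ₑ ^ (2 : ℝ) ∂μ :=
        hB.2 Ω mΩ μ F Y inferInstance hY N
    _ ≤ _ := by
        gcongr
        rw [← lintegral_finsetSum _ fun i _ => (hYm i).enorm.pow_const _]
        have : ∀ i, ∫⁻ ω in {ω | d < ‖X i ω‖}, ‖X i ω‖ₑ ^ (2 : ℝ) ∂μ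
            = ∫⁻ ω, (if d < ‖X i ω‖ then ‖X i ω‖ₑ ^ (2 : ℝ) else 0) ∂μ := by
          intro i
          rw [← lintegral_indicator (hmX i)]
          simp [Set.indicator_apply]
        simp_rw [this]
        rw [← lintegral_finsetSum _ fun i _ =>
            Measurable.ite (hmX i) ((hXm i).enorm.pow_const _) measurable_const,
          ← lintegral_indicator_const hmS, ← lintegral_add_left
            (measurable_const.indicator hmS)]
        refine lintegral_mono fun ω => ?_
        have key := ENNReal.ofReal_le_ofReal
          (sum_sq_betweenCrossings_le lam d (fun k => X k ω) N)
        have nn : ∀ (p : ℕ → Prop) (i : ℕ), i ∈ Finset.range N →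
            0 ≤ (if p i then ‖X i ω‖ ^ 2 else 0) := fun p i _ => by
          split_ifs <;> positivity
        rw [ENNReal.ofReal_add (by split_ifs <;> positivity)
          (Finset.sum_nonneg (nn _)), ENNReal.ofReal_sum_of_nonneg (nn _),
          ENNReal.ofReal_sum_of_nonneg (nn _)] at key
        convert key using 2 with i hi
        · simp only [hYdef]
          split_ifs <;> simp
        · simp [Set.indicator_apply, apply_ite ENNReal.ofReal]
        · simp [apply_ite ENNReal.ofReal]

end MartingaleDifference

/-! ### Stationary sequences -/

/-- The second moment `E[‖X‖ ^ 2; ‖X‖ > z]` of the tail of `X`, in `[0, ∞]`. -/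
noncomputable def tailSecondMoment {Ω B : Type*} [NormedAddCommGroup B] {mΩ : MeasurableSpace Ω}
    (X : Ω → B) (μ : Measure Ω) (z : ℝ) : ℝ≥0∞ :=
  ∫⁻ ω in {ω | z < ‖X ω‖}, ‖X ω‖ₑ ^ (2 : ℝ) ∂μ

section TailSecondMoment

variable {Ω B : Type*} [NormedAddCommGroup B] {mΩ : MeasurableSpace Ω} {μ : Measure Ω}

theorem tailSecondMoment_anti (X : Ω → B) (μ : Measure Ω) : Antitone (tailSecondMoment X μ) :=
  fun _ _ h => lintegral_mono_set fun _ hω => lt_of_le_of_lt h hω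

theorem tailSecondMoment_eq_lintegral_indicator {X : Ω → B} (hX : StronglyMeasurable X) (z : ℝ) :
    tailSecondMoment X μ z
      = ∫⁻ ω, {ω | z < ‖X ω‖}.indicator (fun ω => ‖X ω‖ₑ ^ (2 : ℝ)) ω ∂μ :=
  (lintegral_indicator (hX.norm.measurable measurableSet_Ioi) _).symm

theorem tailSecondMoment_comp {X : Ω → B} (hX : StronglyMeasurable X) {T : Ω → Ω}
    (hT : MeasurePreserving T μ μ) (z : ℝ) :
    tailSecondMoment (X ∘ T) μ z = tailSecondMoment X μ z :=
  hT.setLIntegral_comp_preimage (s := {ω | z < ‖X ω‖}) (hX.norm.measurable measurableSet_Ioi)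
    (hX.enorm.pow_const _)

/-- Markov's inequality, once the values at most `c` have been discarded from the sum. -/
theorem measure_lt_sum_sq_le {X : ℕ → Ω → B} (hX : ∀ i, StronglyMeasurable (X i)) {c d : ℝ}
    (N : ℕ) (hcd : 2 * N * c ^ 2 ≤ d ^ 2) :
    ENNReal.ofReal (d ^ 2 / 2) * μ {ω | d ^ 2 < ∑ i ∈ Finset.range N, ‖X i ω‖ ^ 2}
      ≤ ∑ i ∈ Finset.range N, tailSecondMoment (X i) μ c := by
  have hm : ∀ i, Measurable ({ω | c < ‖X i ω‖}.indicator fun ω => ‖X i ω‖ₑ ^ (2 : ℝ)) :=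
    fun i => ((hX i).enorm.pow_const _).indicator ((hX i).norm.measurable measurableSet_Ioi)
  simp_rw [fun i => tailSecondMoment_eq_lintegral_indicator (μ := μ) (hX i) c]
  rw [← lintegral_finsetSum _ fun i _ => hm i]
  refine le_trans ?_ (mul_meas_ge_le_lintegral (Finset.measurable_fun_sum _ fun i _ => hm i)
    (ENNReal.ofReal (d ^ 2 / 2)))
  gcongr with ω
  intro hω
  have h1 : ∑ i ∈ Finset.range N, ‖X i ω‖ ^ 2
      ≤ ∑ i ∈ Finset.range N, (c ^ 2 + {ω | c < ‖X i ω‖}.indicator (fun ω => ‖X i ω‖ ^ 2) ω) := by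
    refine Finset.sum_le_sum fun i _ => ?_
    by_cases h : c < ‖X i ω‖
    · rw [Set.indicator_of_mem (by exact h)]
      nlinarith
    · rw [Set.indicator_of_notMem (by exact h)]
      have := pow_le_pow_left₀ (norm_nonneg (X i ω)) (not_lt.mp h) 2
      linarith
  rw [Finset.sum_add_distrib, Finset.sum_const, Finset.card_range, nsmul_eq_mul] at h1
  have h2 : d ^ 2 / 2
      ≤ ∑ i ∈ Finset.range N, {ω | c < ‖X i ω‖}.indicator (fun ω => ‖X i ω‖ ^ 2) ω := by
    linarith
  refine (ENNReal.ofReal_le_ofReal h2).trans_eq ?_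
  rw [ENNReal.ofReal_sum_of_nonneg fun i _ => Set.indicator_nonneg (fun _ _ => by positivity) _]
  refine Finset.sum_congr rfl fun i _ => ?_
  by_cases h : c < ‖X i ω‖
  · rw [Set.indicator_of_mem (by exact h), Set.indicator_of_mem (by exact h),
      enorm_rpow_two_eq_ofReal]
  · rw [Set.indicator_of_notMem (by exact h), Set.indicator_of_notMem (by exact h),
      ENNReal.ofReal_zero]

end TailSecondMoment

theorem largeDeviationProb_eq {Ω B : Type*} [NormedAddCommGroup B] {mΩ : MeasurableSpace Ω}
    (μ : Measure Ω) (T : Ω → Ω) (m : Ω → B) (n : ℕ) {x : ℝ} (hx : 0 ≤ x) :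
    largeDeviationProb μ T m n x
      = μ {ω | ∃ i ≤ 2 ^ n, 2 ^ n * x < ‖∑ k ∈ Finset.range i, (m ∘ T^[k]) ω‖} := by
  unfold largeDeviationProb maxPartialSum
  congr 1
  ext ω
  have h0 : (0 : ℝ) ≤ 2 ^ n * x := by positivity
  simp only [Set.mem_ofPred_eq]
  rw [← Real.coe_toNNReal _ h0, NNReal.coe_lt_coe, Finset.lt_sup_iff]
  simp only [Finset.mem_Icc, ← NNReal.coe_lt_coe, coe_nnnorm, birkhoffSum, Function.comp_apply]
  constructor
  · rintro ⟨i, hi, h⟩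
    exact ⟨i, hi.2, h⟩
  · rintro ⟨i, hi, h⟩
    refine ⟨i, ⟨Nat.one_le_iff_ne_zero.mpr ?_, hi⟩, h⟩
    rintro rfl
    simp only [Finset.range_zero, Finset.sum_empty, norm_zero] at h
    exact absurd h (not_lt.mpr (NNReal.coe_nonneg _))

theorem ENNReal.le_ofReal_inv_mul_of_ofReal_mul_le {a : ℝ} (ha : 0 < a) {p q : ℝ≥0∞}
    (h : ENNReal.ofReal a * p ≤ q) : p ≤ ENNReal.ofReal a⁻¹ * q := by
  refine le_trans (le_of_eq ?_) (mul_le_mul_right h _)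
  rw [← mul_assoc, ← ENNReal.ofReal_mul (by positivity), inv_mul_cancel₀ ha.ne',
    ENNReal.ofReal_one, one_mul]

/-- The good-`λ` inequality at the level `lam = 2 ^ n * x`, for a stationary sequence.  The
truncation level of the second moment is of the order `2 ^ (n / 2) * x`. -/
theorem largeDeviationProb_three_mul_le {Ω : Type v} {B : Type u} [NormedAddCommGroup B]
    [NormedSpace ℝ B] [CompleteSpace B] {D : ℝ≥0} (hB : IsSmoothSpaceWith.{u, v} 2 D B)
    {mΩ : MeasurableSpace Ω} {μ : Measure Ω} [IsProbabilityMeasure μ] {F : Filtration ℕ mΩ}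
    {T : Ω → Ω} (hT : MeasurePreserving T μ μ) {m : Ω → B}
    (hm : IsMartingaleDifference μ F fun i => m ∘ T^[i]) {δ : ℝ} (hδ : 0 < δ) (hδ1 : δ ≤ 1)
    (n : ℕ) {x : ℝ} (hx : 0 < x) :
    largeDeviationProb μ T m n (3 * x)
      ≤ ENNReal.ofReal (2 * D * δ ^ 2) * largeDeviationProb μ T m n x +
        ENNReal.ofReal ((D + 2 / δ ^ 2) / (2 ^ (n / 2 : ℝ) * x) ^ 2) *
          tailSecondMoment m μ (δ / 2 * (2 ^ (n / 2 : ℝ) * x)) := by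
  have hms : StronglyMeasurable m := (hm.measurable 0).mono (F.le 0)
  have hXs : ∀ i, StronglyMeasurable (m ∘ T^[i]) := fun i => (hm.measurable i).mono (F.le i)
  set y : ℝ := 2 ^ (n / 2 : ℝ) * x with hy
  have hp0 : (0 : ℝ) < 2 ^ (n / 2 : ℝ) := by positivity
  have hp2 : ((2 : ℝ) ^ (n / 2 : ℝ)) ^ 2 = 2 ^ n := by
    rw [← Real.rpow_natCast, ← Real.rpow_mul (by norm_num), ← Real.rpow_natCast]
    congr 1
    push_cast
    ring
  have hy0 : 0 < y := by positivity
  have hN : (0 : ℝ) < 2 ^ n := by positivity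
  have hp1 : (2 : ℝ) ^ (n / 2 : ℝ) ≤ 2 ^ n := by
    rw [← Real.rpow_natCast]
    exact Real.rpow_le_rpow_of_exponent_le (by norm_num) (by linarith [n.cast_nonneg (α := ℝ)])
  have hy2 : (2 ^ n * x) ^ 2 = 2 ^ n * y ^ 2 := by
    rw [hy, mul_pow (2 ^ (n / 2 : ℝ)) x, hp2]
    ring
  set lam : ℝ := 2 ^ n * x with hlam
  have hlam0 : 0 < lam := by positivity
  clear_value lam y
  set I := tailSecondMoment m μ (δ / 2 * y) with hI
  have hsum : ∀ z, ∑ i ∈ Finset.range (2 ^ n), tailSecondMoment (m ∘ T^[i]) μ z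
      = ENNReal.ofReal (2 ^ n) * tailSecondMoment m μ z := by
    intro z
    simp_rw [fun i => tailSecondMoment_comp hms (hT.iterate i) z]
    rw [Finset.sum_const, Finset.card_range, nsmul_eq_mul]
    congr 1
    rw [ENNReal.ofReal_pow (by norm_num)]
    simp
  have hgood := hm.good_lambda hB (lam := lam) (d := δ * lam) hlam0 (by positivity)
    (by nlinarith) (2 ^ n)
  have hbad := measure_lt_sum_sq_le (μ := μ) hXs (c := δ / 2 * y) (d := δ * lam) (2 ^ n) (by
    push_cast
    rw [mul_pow δ lam, hy2]
    have : 0 ≤ δ ^ 2 * (2 ^ n * y ^ 2) := by positivity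
    nlinarith)
  rw [hsum] at hbad
  have hgood' : μ {ω | (∃ i ≤ 2 ^ n, 3 * lam < ‖∑ k ∈ Finset.range i, (m ∘ T^[k]) ω‖) ∧
        ∑ k ∈ Finset.range (2 ^ n), ‖(m ∘ T^[k]) ω‖ ^ 2 ≤ (δ * lam) ^ 2}
      ≤ ENNReal.ofReal (2 * D * δ ^ 2) * largeDeviationProb μ T m n x
        + ENNReal.ofReal (D / y ^ 2) * I := by
    have h1 : ∑ i ∈ Finset.range (2 ^ n), ∫⁻ ω in {ω | δ * lam < ‖(m ∘ T^[i]) ω‖},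
        ‖(m ∘ T^[i]) ω‖ₑ ^ (2 : ℝ) ∂μ ≤ ENNReal.ofReal (2 ^ n) * I := by
      refine (hsum (δ * lam)).trans_le ?_
      gcongr
      refine tailSecondMoment_anti m μ ?_
      have : y ≤ lam := hy ▸ hlam ▸ mul_le_mul_of_nonneg_right hp1 hx.le
      nlinarith
    have h2 := ENNReal.le_ofReal_inv_mul_of_ofReal_mul_le (by positivity)
      (hgood.trans (mul_le_mul_right (add_le_add_right h1 _) _))
    refine h2.trans_eq ?_
    rw [largeDeviationProb_eq μ T m n hx.le, ← hlam, ← ENNReal.ofReal_coe_nnreal, ← mul_assoc,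
      mul_add,
      ← mul_assoc, ← mul_assoc, ← ENNReal.ofReal_mul (by positivity),
      ← ENNReal.ofReal_mul (by positivity), ← ENNReal.ofReal_mul (by positivity)]
    congr 3
    · field_simp
    · rw [hy2]
      field_simp
  have hbad' : μ {ω | (δ * lam) ^ 2 < ∑ i ∈ Finset.range (2 ^ n), ‖(m ∘ T^[i]) ω‖ ^ 2}
      ≤ ENNReal.ofReal (2 / δ ^ 2 / y ^ 2) * I := by
    refine (ENNReal.le_ofReal_inv_mul_of_ofReal_mul_le (by positivity) hbad).trans_eq ?_
    rw [← mul_assoc, ← ENNReal.ofReal_mul (by positivity)]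
    congr 2
    rw [mul_pow δ lam, hy2]
    field_simp
  rw [largeDeviationProb_eq μ T m n (by positivity : 0 ≤ 3 * x)]
  calc _ ≤ μ ({ω | (∃ i ≤ 2 ^ n, 3 * lam < ‖∑ k ∈ Finset.range i, (m ∘ T^[k]) ω‖) ∧
        ∑ k ∈ Finset.range (2 ^ n), ‖(m ∘ T^[k]) ω‖ ^ 2 ≤ (δ * lam) ^ 2} ∪
        {ω | (δ * lam) ^ 2 < ∑ i ∈ Finset.range (2 ^ n), ‖(m ∘ T^[i]) ω‖ ^ 2}) := by
        refine measure_mono fun ω hω => ?_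
        rw [Set.mem_ofPred_eq, show (2 : ℝ) ^ n * (3 * x) = 3 * lam by rw [hlam]; ring] at hω
        rcases le_or_gt (∑ k ∈ Finset.range (2 ^ n), ‖(m ∘ T^[k]) ω‖ ^ 2) ((δ * lam) ^ 2) with h | h
        · exact Or.inl ⟨hω, h⟩
        · exact Or.inr h
    _ ≤ _ := (measure_union_le _ _).trans (add_le_add hgood' hbad')
    _ = _ := by
        rw [add_assoc, ← add_mul, ← ENNReal.ofReal_add (by positivity) (by positivity), ← add_div]

/-! ### Self-similar inequalities -/

/-- Iterating `h (3 * x) ≤ h x / 2 + c` towards `x → 0` costs a geometric series.  Instead of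
iterating, compare the finite supremum of `h` over `(0, x₀]` with itself. -/
theorem le_two_mul_of_three_mul_le {h : ℝ → ℝ≥0∞} {c : ℝ≥0∞}
    (hrec : ∀ x, 0 < x → h (3 * x) ≤ h x / 2 + c)
    (hbdd : ∀ x₀, 0 < x₀ → ∃ K ≠ ∞, ∀ x, 0 < x → x ≤ x₀ → h x ≤ K) {x : ℝ} (hx : 0 < x) :
    h x ≤ 2 * c := by
  obtain ⟨K, hK, hKb⟩ := hbdd x hx
  set H := ⨆ y ∈ Set.Ioc 0 x, h y with hH
  have hHt : H ≠ ∞ := ne_top_of_le_ne_top hK (iSup₂_le fun y hy => hKb y hy.1 hy.2)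
  have h1 : H ≤ H / 2 + c := by
    refine iSup₂_le fun y hy => ?_
    have hy3 : 0 < y / 3 := div_pos hy.1 (by norm_num)
    have h2 := hrec (y / 3) hy3
    rw [mul_div_cancel₀ y (by norm_num : (3 : ℝ) ≠ 0)] at h2
    refine h2.trans ?_
    gcongr
    exact le_iSup₂ (f := fun y (_ : y ∈ Set.Ioc 0 x) => h y) (y / 3)
      ⟨hy3, by linarith [hy.1, hy.2]⟩
  have hhalf : H / 2 ≠ ∞ := ENNReal.div_ne_top hHt (by norm_num)
  have h2 : H / 2 ≤ c :=
    (ENNReal.add_le_add_iff_left hhalf).mp (by rwa [ENNReal.add_halves])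
  calc h x ≤ H := le_iSup₂ (f := fun y (_ : y ∈ Set.Ioc 0 x) => h y) x ⟨hx, le_rfl⟩
    _ = H / 2 + H / 2 := (ENNReal.add_halves H).symm
    _ ≤ c + c := add_le_add h2 h2
    _ = 2 * c := (two_mul c).symm

/-- The error term `r n x` need not be uniformly small near `x = 0`, but only the finitely many
points `x / 3 ^ j` enter when the uniform bound `K` is halved `k` times. -/
theorem tendsto_zero_of_three_mul_le {h r : ℕ → ℝ → ℝ≥0∞} {K : ℝ≥0∞} (hK : K ≠ ∞)
    (hrec : ∀ n x, 0 < x → h n (3 * x) ≤ h n x / 2 + r n x)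
    (hbdd : ∀ n x, 0 < x → h n x ≤ K)
    (hr : ∀ x, 0 < x → Tendsto (fun n => r n x) atTop (𝓝 0)) {x : ℝ} (hx : 0 < x) :
    Tendsto (fun n => h n x) atTop (𝓝 0) := by
  rw [ENNReal.tendsto_nhds_zero]
  intro ε hε
  have hε2 : ε / 2 ≠ 0 := (ENNReal.half_pos hε.ne').ne'
  have hε4 : 0 < ε / 2 / 2 := ENNReal.half_pos hε2
  have key : ∀ k : ℕ, ∀ x, 0 < x → ∀ᶠ n in atTop, h n x ≤ K * 2⁻¹ ^ k + ε / 2 := by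
    intro k
    induction k with
    | zero =>
      intro x hx
      refine Eventually.of_forall fun n => (hbdd n x hx).trans ?_
      simp
    | succ k ih =>
      intro x hx
      have hx3 : 0 < x / 3 := by positivity
      filter_upwards [ih (x / 3) hx3, (ENNReal.tendsto_nhds_zero.mp (hr (x / 3) hx3)) _ hε4]
        with n h1 h2
      have h3 := hrec n (x / 3) hx3
      rw [mul_div_cancel₀ x (by norm_num : (3 : ℝ) ≠ 0)] at h3
      calc h n x ≤ (K * 2⁻¹ ^ k + ε / 2) / 2 + ε / 2 / 2 :=
            h3.trans (add_le_add (ENNReal.div_le_div_right h1 _) h2)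
        _ = K * 2⁻¹ ^ (k + 1) + ε / 2 := by
            rw [ENNReal.add_div, add_assoc, ENNReal.add_halves, pow_succ, ← mul_assoc,
              div_eq_mul_inv]
  have hlim : Tendsto (fun k : ℕ => K * 2⁻¹ ^ k) atTop (𝓝 0) := by
    have := ENNReal.Tendsto.const_mul
      (ENNReal.tendsto_pow_atTop_nhds_zero_of_lt_one (r := 2⁻¹) (by simp))
      (Or.inr hK) (a := K)
    simpa using this
  obtain ⟨k, hk⟩ := ((ENNReal.tendsto_nhds_zero.mp hlim) _ (pos_iff_ne_zero.mpr hε2)).exists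
  filter_upwards [key k x hx] with n hn
  calc h n x ≤ ε / 2 + ε / 2 := hn.trans (add_le_add_left hk _)
    _ = ε := ENNReal.add_halves ε

/-! ### Tails of the second moment -/

/-- A geometric sequence stopped at `v` sums to at most a constant times `v`: each term is bounded
by an increment of `min (β * q ^ n) (q * v)`, up to the factor `q - 1`. -/
theorem sum_geometric_lt_le {q β v : ℝ} (hq : 1 < q) (hβ : 0 ≤ β) (hv : 0 ≤ v) (M : ℕ) :
    ∑ n ∈ Finset.range M, (if β * q ^ n < v then β * q ^ n else 0) ≤ q / (q - 1) * v := by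
  have hq1 : 0 < q - 1 := by linarith
  have hterm : ∀ n, (if β * q ^ n < v then β * q ^ n else 0)
      ≤ (min (β * q ^ (n + 1)) (q * v) - min (β * q ^ n) (q * v)) / (q - 1) := by
    intro n
    have hpos : 0 ≤ β * q ^ n := by positivity
    have hsucc : β * q ^ (n + 1) = q * (β * q ^ n) := by ring
    rw [le_div_iff₀ hq1, hsucc]
    split_ifs with h
    · rw [min_eq_left (by nlinarith), min_eq_left (by nlinarith)]
      linarith
    · have : min (β * q ^ n) (q * v) ≤ min (q * (β * q ^ n)) (q * v) :=
        min_le_min_right _ (by nlinarith)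
      linarith
  calc _ ≤ ∑ n ∈ Finset.range M,
        (min (β * q ^ (n + 1)) (q * v) - min (β * q ^ n) (q * v)) / (q - 1) :=
        Finset.sum_le_sum fun n _ => hterm n
    _ = (min (β * q ^ M) (q * v) - min (β * q ^ 0) (q * v)) / (q - 1) := by
        rw [← Finset.sum_div, Finset.sum_range_sub fun n => min (β * q ^ n) (q * v)]
    _ ≤ q * v / (q - 1) := by
        gcongr
        have : 0 ≤ min (β * q ^ 0) (q * v) := le_min (by positivity) (by positivity)
        linarith [min_le_right (β * q ^ M) (q * v)]
    _ = _ := by ring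

section Tails

variable {Ω B : Type*} [NormedAddCommGroup B] {mΩ : MeasurableSpace Ω} {μ : Measure Ω}
  {m : Ω → B} {s : ℝ}

/-- Dyadic decomposition of `{z < ‖m‖}`. -/
theorem tailSecondMoment_le_tsum (hm : StronglyMeasurable m) {z : ℝ} (hz : 0 < z) :
    tailSecondMoment m μ z
      ≤ ∑' k : ℕ, ENNReal.ofReal (4 ^ (k + 1) * z ^ 2) * μ {ω | 2 ^ k * z < ‖m ω‖} := by
  have hms : ∀ t : ℝ, MeasurableSet {ω | t < ‖m ω‖} := fun t => hm.norm.measurable measurableSet_Ioi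
  simp_rw [fun k : ℕ => (lintegral_indicator_const (μ := μ) (hms (2 ^ k * z))
    (ENNReal.ofReal (4 ^ (k + 1) * z ^ 2))).symm]
  rw [← lintegral_tsum fun k => (measurable_const.indicator (hms _)).aemeasurable,
    tailSecondMoment_eq_lintegral_indicator hm]
  refine lintegral_mono fun ω => ?_
  by_cases h : z < ‖m ω‖
  · have h1 : 1 ≤ ‖m ω‖ / z := (one_le_div hz).mpr h.le
    -- the strict inequality at the lower end needs the half-open intervals `(2 ^ k, 2 ^ (k + 1)]`
    obtain ⟨k, hk1, hk2⟩ : ∃ k : ℕ, 2 ^ k * z < ‖m ω‖ ∧ ‖m ω‖ ≤ 2 ^ (k + 1) * z := by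
      obtain ⟨k, hk1, hk2⟩ := exists_nat_pow_near h1 (by norm_num : (1 : ℝ) < 2)
      rw [le_div_iff₀ hz] at hk1
      rw [div_lt_iff₀ hz] at hk2
      rcases hk1.lt_or_eq with hlt | heq
      · exact ⟨k, hlt, hk2.le⟩
      · cases k with
        | zero => simp at heq; linarith
        | succ k =>
          refine ⟨k, lt_of_lt_of_le ?_ hk1, heq.ge⟩
          rw [pow_succ]
          have : (0 : ℝ) < 2 ^ k * z := by positivity
          linarith
    refine le_trans ?_ (ENNReal.le_tsum k)
    rw [Set.indicator_of_mem (by exact h), Set.indicator_of_mem (by exact hk1),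
      enorm_rpow_two_eq_ofReal]
    refine ENNReal.ofReal_le_ofReal ((pow_le_pow_left₀ (norm_nonneg _) hk2 2).trans_eq ?_)
    rw [mul_pow, ← pow_mul, mul_comm (k + 1) 2, pow_mul]
    norm_num
  · rw [Set.indicator_of_notMem (by exact h)]
    exact zero_le

theorem rpow_mul_tailSecondMoment_le (hs : 2 < s) (hm : StronglyMeasurable m) {z : ℝ} (hz : 0 < z)
    {W : ℝ≥0∞} (hW : ∀ t, z ≤ t → ENNReal.ofReal (t ^ s) * μ {ω | t < ‖m ω‖} ≤ W) :
    ENNReal.ofReal (z ^ (s - 2)) * tailSecondMoment m μ z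
      ≤ ENNReal.ofReal (4 * (1 - 2 ^ (2 - s))⁻¹) * W := by
  have hq0 : (0 : ℝ) < 2 ^ (2 - s) := by positivity
  have hq1 : (2 : ℝ) ^ (2 - s) < 1 := Real.rpow_lt_one_of_one_lt_of_neg (by norm_num) (by linarith)
  have hterm : ∀ k : ℕ, ENNReal.ofReal (z ^ (s - 2)) *
      (ENNReal.ofReal (4 ^ (k + 1) * z ^ 2) * μ {ω | 2 ^ k * z < ‖m ω‖})
      ≤ ENNReal.ofReal (4 * (2 ^ (2 - s)) ^ k) * W := by
    intro k
    have h2k : (1 : ℝ) ≤ 2 ^ k := one_le_pow₀ (by norm_num)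
    have h1 := hW (2 ^ k * z) (by nlinarith)
    refine le_trans (le_of_eq ?_) (mul_le_mul_right h1 _)
    rw [← mul_assoc, ← mul_assoc, ← ENNReal.ofReal_mul (by positivity),
      ← ENNReal.ofReal_mul (by positivity)]
    congr 2
    have e1 : z ^ (s - 2) * z ^ 2 = z ^ s := by
      rw [← Real.rpow_natCast z 2, ← Real.rpow_add hz]
      congr 1
      push_cast
      ring
    have e2 : ((2 : ℝ) ^ (2 - s)) ^ k * (2 ^ k) ^ s = 4 ^ k := by
      rw [← Real.rpow_natCast, ← Real.rpow_natCast, ← Real.rpow_mul (by norm_num),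
        ← Real.rpow_mul (by norm_num), ← Real.rpow_add (by norm_num),
        show (2 - s) * (k : ℝ) + k * s = 2 * k by ring, Real.rpow_mul (by norm_num)]
      norm_num
    rw [Real.mul_rpow (by positivity) hz.le, pow_succ, ← e2, ← e1]
    ring
  calc _ ≤ ENNReal.ofReal (z ^ (s - 2)) *
        ∑' k : ℕ, ENNReal.ofReal (4 ^ (k + 1) * z ^ 2) * μ {ω | 2 ^ k * z < ‖m ω‖} := by
        gcongr
        exact tailSecondMoment_le_tsum hm hz
    _ ≤ ∑' k : ℕ, ENNReal.ofReal (4 * (2 ^ (2 - s)) ^ k) * W := by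
        rw [← ENNReal.tsum_mul_left]
        exact ENNReal.tsum_le_tsum hterm
    _ = _ := by
        rw [ENNReal.tsum_mul_right, ← ENNReal.ofReal_tsum_of_nonneg (fun k => by positivity)
          ((summable_geometric_of_lt_one hq0.le hq1).mul_left 4), tsum_mul_left,
          tsum_geometric_of_lt_one hq0.le hq1]

/-- Only the terms with `b * ρ ^ n < ‖m ω‖` contribute at `ω`, and they form a geometric sum
dominated by its last term. -/
theorem sum_rpow_mul_tailSecondMoment_le (hs : 2 < s) (hm : StronglyMeasurable m) {b ρ : ℝ}
    (hb : 0 < b) (hρ : 1 < ρ) (M : ℕ) :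
    ∑ n ∈ Finset.range M,
        ENNReal.ofReal ((b * ρ ^ n) ^ (s - 2)) * tailSecondMoment m μ (b * ρ ^ n)
      ≤ ENNReal.ofReal (ρ ^ (s - 2) / (ρ ^ (s - 2) - 1)) * ∫⁻ ω, ‖m ω‖ₑ ^ s ∂μ := by
  have hρ0 : 0 < ρ := by linarith
  have hms : ∀ t : ℝ, MeasurableSet {ω | t < ‖m ω‖} := fun t => hm.norm.measurable measurableSet_Ioi
  have hmi : ∀ t : ℝ, Measurable ({ω | t < ‖m ω‖}.indicator fun ω => ‖m ω‖ₑ ^ (2 : ℝ)) := fun t =>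
    (hm.enorm.pow_const _).indicator (hms t)
  have hq : 1 < ρ ^ (s - 2) := Real.one_lt_rpow hρ (by linarith)
  simp_rw [fun n : ℕ => tailSecondMoment_eq_lintegral_indicator (μ := μ) hm (b * ρ ^ n)]
  simp_rw [fun n : ℕ => (lintegral_const_mul (μ := μ) (ENNReal.ofReal ((b * ρ ^ n) ^ (s - 2)))
    (hmi (b * ρ ^ n))).symm]
  rw [← lintegral_finsetSum _ fun n _ => (hmi _).const_mul _,
    ← lintegral_const_mul _ (hm.enorm.pow_const _)]
  refine lintegral_mono fun ω => ?_
  set t := ‖m ω‖ with ht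
  have ht0 : 0 ≤ t := norm_nonneg _
  have hpow : ∀ n : ℕ, (b * ρ ^ n) ^ (s - 2) = b ^ (s - 2) * (ρ ^ (s - 2)) ^ n := by
    intro n
    rw [Real.mul_rpow hb.le (by positivity), ← Real.rpow_natCast, ← Real.rpow_natCast,
      ← Real.rpow_mul hρ0.le, ← Real.rpow_mul hρ0.le, mul_comm (n : ℝ)]
  have hterm : ∀ n : ℕ, ENNReal.ofReal ((b * ρ ^ n) ^ (s - 2)) *
      {ω | b * ρ ^ n < ‖m ω‖}.indicator (fun ω => ‖m ω‖ₑ ^ (2 : ℝ)) ω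
      = ENNReal.ofReal ((if b ^ (s - 2) * (ρ ^ (s - 2)) ^ n < t ^ (s - 2)
          then b ^ (s - 2) * (ρ ^ (s - 2)) ^ n else 0) * t ^ 2) := by
    intro n
    rw [← hpow]
    have hiff : (b * ρ ^ n) ^ (s - 2) < t ^ (s - 2) ↔ b * ρ ^ n < t :=
      Real.rpow_lt_rpow_iff (by positivity) ht0 (by linarith)
    by_cases h : b * ρ ^ n < t
    · rw [Set.indicator_of_mem (by exact h), if_pos (hiff.mpr h), enorm_rpow_two_eq_ofReal,
        ← ENNReal.ofReal_mul (by positivity)]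
    · rw [Set.indicator_of_notMem (by exact h), if_neg (hiff.not.mpr h)]
      simp
  simp_rw [hterm]
  rw [← ENNReal.ofReal_sum_of_nonneg fun n _ =>
      mul_nonneg (by split_ifs <;> positivity) (by positivity),
    ← ofReal_norm, ENNReal.ofReal_rpow_of_nonneg ht0 (by linarith),
    ← ENNReal.ofReal_mul (div_nonneg (by positivity) (by linarith)), ← Finset.sum_mul]
  refine ENNReal.ofReal_le_ofReal ?_
  have h1 := sum_geometric_lt_le hq (β := b ^ (s - 2)) (v := t ^ (s - 2)) (by positivity)
    (by positivity) M
  calc _ ≤ ρ ^ (s - 2) / (ρ ^ (s - 2) - 1) * t ^ (s - 2) * t ^ 2 := by gcongr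
    _ = _ := by
      rw [mul_assoc]
      congr 1
      rw [← Real.rpow_natCast t 2, ← Real.rpow_add_of_nonneg ht0 (by linarith) (by norm_num)]
      congr 1
      push_cast
      ring

theorem weakMoment_lt_top_of_memWeakLpZero [IsProbabilityMeasure μ] (hs : 0 < s)
    (hm : MemWeakLpZero s m μ) : weakMoment s m μ < ∞ := by
  obtain ⟨t₀, ht₀⟩ := eventually_atTop.mp ((ENNReal.tendsto_nhds_zero.mp hm.2) 1 one_pos)
  refine lt_of_le_of_lt (iSup₂_le fun t ht => ?_ : _ ≤ max 1 (ENNReal.ofReal (t₀ ^ s)))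
    (max_lt ENNReal.one_lt_top ENNReal.ofReal_lt_top)
  rcases le_total t₀ t with h | h
  · exact (ht₀ t h).trans (le_max_left _ _)
  · refine le_trans ?_ (le_max_right _ _)
    calc _ ≤ ENNReal.ofReal (t₀ ^ s) * 1 := by
          gcongr
          exact prob_le_one
      _ = _ := mul_one _

theorem tendsto_rpow_mul_tailSecondMoment (hs : 2 < s) (hms : StronglyMeasurable m)
    (hm : MemWeakLpZero s m μ) :
    Tendsto (fun z : ℝ => ENNReal.ofReal (z ^ (s - 2)) * tailSecondMoment m μ z) atTop (𝓝 0) := by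
  have hlim : Tendsto (fun W : ℝ≥0∞ => ENNReal.ofReal (4 * (1 - 2 ^ (2 - s))⁻¹) * W)
      (𝓝 0) (𝓝 0) := by
    have := ENNReal.Tendsto.const_mul (tendsto_id (α := ℝ≥0∞) (x := 𝓝 0))
      (Or.inr ENNReal.ofReal_ne_top) (a := ENNReal.ofReal (4 * (1 - 2 ^ (2 - s))⁻¹))
    simpa using this
  rw [ENNReal.tendsto_nhds_zero]
  intro ε hε
  obtain ⟨η, hη, hηε⟩ : ∃ η > 0, ENNReal.ofReal (4 * (1 - 2 ^ (2 - s))⁻¹) * η ≤ ε := by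
    have h1 := (ENNReal.tendsto_nhds_zero.mp hlim) ε hε
    obtain ⟨η, h2, h3⟩ := (ENNReal.nhds_zero_basis.eventually_iff.mp h1)
    obtain ⟨η', h4, h5⟩ := exists_between h2
    exact ⟨η', h4, h3 h5⟩
  obtain ⟨t₀, ht₀⟩ := eventually_atTop.mp ((ENNReal.tendsto_nhds_zero.mp hm.2) η hη)
  filter_upwards [eventually_ge_atTop t₀, eventually_gt_atTop 0] with z hz hz0
  exact (rpow_mul_tailSecondMoment_le hs hms hz0 fun t ht => ht₀ t (hz.trans ht)).trans hηε

end Tails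

/-! ### Normalized deviation probabilities -/

/-- The normalization `x ^ s * 2 ^ (n s / 2) * P(max_{i ≤ 2 ^ n} ‖S_i‖ > 2 ^ n * x)` of the
deviation probability. -/
noncomputable def normalizedDeviation {Ω B : Type*} [NormedAddCommGroup B]
    {mΩ : MeasurableSpace Ω} (s : ℝ) (μ : Measure Ω) (T : Ω → Ω) (m : Ω → B) (n : ℕ) (x : ℝ) :
    ℝ≥0∞ :=
  ENNReal.ofReal (x ^ s) * ENNReal.ofReal (2 ^ (n * s / 2)) * largeDeviationProb μ T m n x

theorem normalizedDeviation_le_of_le {Ω B : Type*} [NormedAddCommGroup B]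
    {mΩ : MeasurableSpace Ω} {s : ℝ} (hs : 0 ≤ s) (μ : Measure Ω) [IsProbabilityMeasure μ]
    (T : Ω → Ω) (m : Ω → B) (n : ℕ) {x x₀ : ℝ} (hx : 0 ≤ x) (hxx : x ≤ x₀) :
    normalizedDeviation s μ T m n x
      ≤ ENNReal.ofReal (x₀ ^ s) * ENNReal.ofReal (2 ^ (n * s / 2)) := by
  calc normalizedDeviation s μ T m n x
      ≤ ENNReal.ofReal (x₀ ^ s) * ENNReal.ofReal (2 ^ (n * s / 2)) * 1 := by
        unfold normalizedDeviation largeDeviationProb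
        gcongr
        exact prob_le_one
    _ = _ := mul_one _

/-- The self-similar inequality satisfied by the normalized deviation probabilities.  The ratio
`δ` of the square function to the level is so small that the probability at level `x` returns with
a factor `2 D δ² ≤ 3 ^ (-s) / 2`, which absorbs the loss `3 ^ s` from passing to level `3 * x`. -/
theorem exists_normalizedDeviation_three_mul_le {s : ℝ} (D : ℝ≥0) :
    ∃ c a : ℝ, 0 < c ∧ 0 < a ∧
      ∀ {Ω : Type v} {B : Type u} [NormedAddCommGroup B] [NormedSpace ℝ B] [CompleteSpace B]
        (_ : IsSmoothSpaceWith.{u, v} 2 D B) {mΩ : MeasurableSpace Ω} {μ : Measure Ω}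
        [IsProbabilityMeasure μ] {F : Filtration ℕ mΩ} {T : Ω → Ω} (_ : MeasurePreserving T μ μ)
        {m : Ω → B} (_ : IsMartingaleDifference μ F fun i => m ∘ T^[i]) (n : ℕ) (x : ℝ), 0 < x →
        normalizedDeviation s μ T m n (3 * x) ≤ normalizedDeviation s μ T m n x / 2 +
          ENNReal.ofReal c * (ENNReal.ofReal ((a * x * √2 ^ n) ^ (s - 2)) *
            tailSecondMoment m μ (a * x * √2 ^ n)) := by
  obtain ⟨δ, hδ, hδ1, hδD⟩ : ∃ δ : ℝ, 0 < δ ∧ δ ≤ 1 ∧ 3 ^ s * (2 * D * δ ^ 2) ≤ 1 / 2 := by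
    have h3 : (0 : ℝ) < 3 ^ s := by positivity
    have hA : 0 < 4 * (3 : ℝ) ^ s * D + 1 := by positivity
    have hA1 : 1 ≤ 4 * (3 : ℝ) ^ s * D + 1 := by
      have : 0 ≤ 4 * (3 : ℝ) ^ s * D := by positivity
      linarith
    refine ⟨(√(4 * 3 ^ s * D + 1))⁻¹, by positivity,
      inv_le_one_of_one_le₀ (Real.one_le_sqrt.mpr hA1), ?_⟩
    rw [inv_pow, Real.sq_sqrt hA.le, ← mul_assoc, ← div_eq_mul_inv, div_le_iff₀ hA]
    linarith
  refine ⟨3 ^ s * (D + 2 / δ ^ 2) * (δ / 2) ^ (2 - s), δ / 2, by positivity, by positivity, ?_⟩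
  intro Ω B _ _ _ hB mΩ μ _ F T hT m hm n x hx
  have h := largeDeviationProb_three_mul_le hB hT hm hδ hδ1 n hx
  have hsqrt : (2 : ℝ) ^ (n / 2 : ℝ) = √2 ^ n := by
    rw [Real.sqrt_eq_rpow, ← Real.rpow_natCast, ← Real.rpow_mul (by norm_num)]
    congr 1
    ring
  have hy : δ / 2 * (2 ^ (n / 2 : ℝ) * x) = δ / 2 * x * √2 ^ n := by
    rw [hsqrt]
    ring
  rw [hy] at h
  unfold normalizedDeviation
  set P := largeDeviationProb μ T m n x
  set I := tailSecondMoment m μ (δ / 2 * x * √2 ^ n)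
  refine (mul_le_mul_right h _).trans ?_
  rw [mul_add]
  refine add_le_add ?_ (le_of_eq ?_)
  · have hhalf : (2⁻¹ : ℝ≥0∞) = ENNReal.ofReal 2⁻¹ := by
      rw [ENNReal.ofReal_inv_of_pos (by norm_num), ENNReal.ofReal_ofNat]
    rw [ENNReal.div_eq_inv_mul, hhalf, ← mul_assoc, ← mul_assoc,
      ← ENNReal.ofReal_mul (by positivity), ← ENNReal.ofReal_mul (by positivity),
      ← ENNReal.ofReal_mul (by positivity), ← ENNReal.ofReal_mul (by positivity)]
    refine mul_le_mul_left (ENNReal.ofReal_le_ofReal ?_) _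
    rw [Real.mul_rpow (by norm_num) hx.le]
    have h0 : 0 ≤ x ^ s * 2 ^ (n * s / 2) := by positivity
    calc _ = 3 ^ s * (2 * D * δ ^ 2) * (x ^ s * 2 ^ (n * s / 2)) := by ring
      _ ≤ 1 / 2 * (x ^ s * 2 ^ (n * s / 2)) := by gcongr
      _ = _ := by ring
  · rw [← mul_assoc, ← mul_assoc, ← ENNReal.ofReal_mul (by positivity),
      ← ENNReal.ofReal_mul (by positivity), ← ENNReal.ofReal_mul (by positivity)]
    congr 2
    set y := 2 ^ (n / 2 : ℝ) * x with hydef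
    have hy0 : 0 < y := by positivity
    have e1 : x ^ s * 2 ^ (n * s / 2) = y ^ s := by
      rw [hydef, Real.mul_rpow (by positivity) hx.le, ← Real.rpow_mul (by norm_num), mul_comm,
        show (n : ℝ) / 2 * s = n * s / 2 by ring]
    have e2 : y ^ s = y ^ (s - 2) * y ^ 2 := by
      rw [← Real.rpow_natCast y 2, ← Real.rpow_add hy0]
      congr 1
      push_cast
      ring
    have e3 : (δ / 2) ^ (2 - s) * (δ / 2) ^ (s - 2) = 1 := by
      rw [← Real.rpow_add (by positivity)]
      simp
    rw [← hy, Real.mul_rpow (by positivity) hy0.le, Real.mul_rpow (by norm_num) hx.le]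
    calc _ = 3 ^ s * (x ^ s * 2 ^ (n * s / 2)) * ((D + 2 / δ ^ 2) / y ^ 2) := by ring
      _ = 3 ^ s * (D + 2 / δ ^ 2) * y ^ (s - 2) := by
        rw [e1, e2]
        field_simp
      _ = 3 ^ s * (D + 2 / δ ^ 2) * y ^ (s - 2) * ((δ / 2) ^ (2 - s) * (δ / 2) ^ (s - 2)) := by
        rw [e3, mul_one]
      _ = _ := by ring

/-- The normalization in `x` is undone by the factor `x ^ (-s)`. -/
theorem ofReal_mul_largeDeviationProb_eq {Ω B : Type*} [NormedAddCommGroup B]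
    {mΩ : MeasurableSpace Ω} (s : ℝ) (μ : Measure Ω) (T : Ω → Ω) (m : Ω → B) (n : ℕ) {x : ℝ}
    (hx : 0 < x) :
    ENNReal.ofReal (2 ^ (n * s / 2)) * largeDeviationProb μ T m n x
      = ENNReal.ofReal (x ^ (-s)) * normalizedDeviation s μ T m n x := by
  unfold normalizedDeviation
  rw [← mul_assoc, ← mul_assoc, ← ENNReal.ofReal_mul (by positivity), ← Real.rpow_add hx]
  simp

theorem corollary1 (s : ℝ) (hs : 2 < s) (B : Type u) [NormedAddCommGroup B]
    [NormedSpace ℝ B] [CompleteSpace B] [TopologicalSpace.SeparableSpace B] (D : ℝ≥0)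
    (hB : IsSmoothSpaceWith.{u, v} 2 D B) :
    ∃ C : ℝ, 0 < C ∧
      ∀ (Ω : Type v) (F₀ mΩ : MeasurableSpace Ω) (μ : Measure Ω) (_ : IsProbabilityMeasure μ)
        (T : Ω ≃ᵐ Ω) (_ : MeasurePreserving T μ μ)
        (hF₀ : F₀ ≤ mΩ) (hT : F₀.comap T.symm ≤ F₀)
        (m : Ω → B)
        (_ : IsMartingaleDifference μ (shiftFiltration F₀ T hF₀ hT) (fun i => m ∘ T^[i])),
        (MemWeakLp s m μ →
          (⨆ (n : ℕ) (_ : 1 ≤ n) (x : ℝ) (_ : 0 < x),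
              ENNReal.ofReal (x ^ s) * ENNReal.ofReal (2 ^ (n * s / 2)) *
                largeDeviationProb μ T m n x)
            ≤ ENNReal.ofReal C * weakMoment s m μ) ∧
        (MemWeakLpZero s m μ →
          ∀ x : ℝ, 0 < x →
            Tendsto (fun n : ℕ => ENNReal.ofReal (2 ^ (n * s / 2)) * largeDeviationProb μ T m n x)
              atTop (𝓝 0)) ∧
        (MemLp m (ENNReal.ofReal s) μ →
          ∀ x : ℝ, 0 < x →
            ∑' n : ℕ, ENNReal.ofReal (2 ^ (((n + 1 : ℕ) : ℝ) * s / 2)) *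
                largeDeviationProb μ T m (n + 1) x
              ≤ ENNReal.ofReal (C * x ^ (-s)) * ∫⁻ ω, ‖m ω‖ₑ ^ s ∂μ) := by
  obtain ⟨c, a, hc, ha, hrec⟩ := exists_normalizedDeviation_three_mul_le.{u, v} (s := s) D
  set K₁ : ℝ := 4 * (1 - 2 ^ (2 - s))⁻¹ with hK₁
  set K₂ : ℝ := √2 ^ (s - 2) / (√2 ^ (s - 2) - 1) with hK₂
  have hsqrt2 : 1 < √2 := Real.lt_sqrt_of_sq_lt (by norm_num)
  have hK₁0 : 0 < K₁ := by
    have : (2 : ℝ) ^ (2 - s) < 1 :=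
      Real.rpow_lt_one_of_one_lt_of_neg (by norm_num) (by linarith)
    have : 0 < 1 - (2 : ℝ) ^ (2 - s) := by linarith
    positivity
  have hK₂0 : 0 < K₂ := by
    have : 1 < √2 ^ (s - 2) := Real.one_lt_rpow hsqrt2 (by linarith)
    exact div_pos (by positivity) (by linarith)
  refine ⟨2 * (c * (K₁ + K₂)), by positivity, ?_⟩
  intro Ω F₀ mΩ μ _ T hTμ hF₀ hT m hm
  have hms : StronglyMeasurable m :=
    (hm.measurable 0).mono ((shiftFiltration F₀ T hF₀ hT).le 0)
  have hrec' := hrec hB hTμ hm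
  have hweak : ∀ n x, 0 < x →
      normalizedDeviation s μ T m n x
        ≤ 2 * (ENNReal.ofReal c * (ENNReal.ofReal K₁ * weakMoment s m μ)) := by
    intro n x hx
    refine le_two_mul_of_three_mul_le (fun x hx => (hrec' n x hx).trans ?_) (fun x₀ hx₀ =>
      ⟨_, ENNReal.mul_ne_top ENNReal.ofReal_ne_top ENNReal.ofReal_ne_top, fun x hx hxx =>
        normalizedDeviation_le_of_le (by linarith) μ T m n hx.le hxx⟩) hx
    refine add_le_add_right (mul_le_mul_right ?_ _) _
    have hz : 0 < a * x * √2 ^ n := by positivity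
    exact rpow_mul_tailSecondMoment_le hs hms hz fun t ht =>
      le_iSup₂ (f := fun (t : ℝ) (_ : 0 < t) => ENNReal.ofReal (t ^ s) * μ {ω | t < ‖m ω‖})
        t (hz.trans_le ht)
  have hmul : ∀ {k : ℝ} {p : ℝ≥0∞}, 0 < k → k ≤ K₁ + K₂ →
      2 * (ENNReal.ofReal c * (ENNReal.ofReal k * p))
        ≤ ENNReal.ofReal (2 * (c * (K₁ + K₂))) * p := by
    intro k p hk hkC
    rw [ENNReal.ofReal_mul (by norm_num), ENNReal.ofReal_mul hc.le, mul_assoc, mul_assoc]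
    gcongr
    norm_num
  refine ⟨fun _ => ?_, fun hm0 x hx => ?_, fun _ x hx => ?_⟩
  · exact iSup₂_le fun n _ => iSup₂_le fun x hx =>
      (hweak n x hx).trans (hmul hK₁0 (by linarith))
  · simp_rw [fun n => ofReal_mul_largeDeviationProb_eq s μ T m n hx]
    have hW := (weakMoment_lt_top_of_memWeakLpZero (by linarith) hm0).ne
    have hlim : Tendsto (fun n => normalizedDeviation s μ T m n x) atTop (𝓝 0) := by
      refine tendsto_zero_of_three_mul_le (by finiteness) hrec' hweak (fun x hx => ?_) hx
      have hz : Tendsto (fun n : ℕ => a * x * √2 ^ n) atTop atTop :=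
        (tendsto_pow_atTop_atTop_of_one_lt hsqrt2).const_mul_atTop (by positivity)
      have := ENNReal.Tendsto.const_mul ((tendsto_rpow_mul_tailSecondMoment hs hms hm0).comp hz)
        (Or.inr ENNReal.ofReal_ne_top) (a := ENNReal.ofReal c)
      simpa using this
    have := ENNReal.Tendsto.const_mul hlim (Or.inr ENNReal.ofReal_ne_top)
      (a := ENNReal.ofReal (x ^ (-s)))
    simpa using this
  · simp_rw [fun n : ℕ => ofReal_mul_largeDeviationProb_eq s μ T m (n + 1) hx]
    rw [ENNReal.tsum_mul_left, mul_comm (2 * _) (x ^ (-s)), ENNReal.ofReal_mul (by positivity),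
      mul_assoc]
    gcongr
    refine ENNReal.tsum_le_of_sum_range_le fun M => ?_
    refine le_trans ?_ (hmul hK₂0 (by linarith))
    -- only a finite sum is known in advance to be bounded near `x = 0`
    refine le_two_mul_of_three_mul_le
      (h := fun x => ∑ n ∈ Finset.range M, normalizedDeviation s μ T m (n + 1) x)
      (fun x hx => ?_) (fun x₀ hx₀ => ⟨_, ?_, fun x hx hxx => Finset.sum_le_sum fun n _ =>
        normalizedDeviation_le_of_le (by linarith) μ T m (n + 1) hx.le hxx⟩) hx
    · refine (Finset.sum_le_sum fun n _ => hrec' (n + 1) x hx).trans ?_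
      rw [Finset.sum_add_distrib]
      simp_rw [div_eq_mul_inv]
      rw [← Finset.sum_mul, ← Finset.mul_sum]
      gcongr
      have hpow : ∀ n : ℕ, a * x * √2 ^ (n + 1) = a * x * √2 * √2 ^ n := fun n => by ring
      simp_rw [hpow]
      exact sum_rpow_mul_tailSecondMoment_le hs hms (by positivity) hsqrt2 M
    · exact ENNReal.sum_ne_top.mpr fun n _ =>
        ENNReal.mul_ne_top ENNReal.ofReal_ne_top ENNReal.ofReal_ne_top
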